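/- **Model.** For each $n\ge 1$ observe $y^n_i=n\int_{[i/n,(i+1)/n)}f_n(x)\,dx+\xi^n_i$, $i=0,\dots,n-1$, where $\xi^n_0,\dots,\xi^n_{n-1}$ are independent, centered and sub-Gaussian with scale $\sigma>0$, i.e. $\mathbb E e^{u\xi^n_i}\le e^{u^2\sigma^2/2}$ for all $u\in\mathbb R$. Let $\mathcal S$ be the set of right-continuous step functions on $[0,1)$ with finitely many jumps, $J(g)$ the set of change-points of $g\in\mathcal S$, and $L>0$. The truth $f_n\in\mathcal S$ satisfies $\#J(f_n)\le k_n$ and $\|f_n\|_{L^\infty}\le L$. Let $\Delta_n\in(0,\infty]$ be its smallest jump size ($\infty$ if $f_n$ is constant) and $\lambda_n\in(0,1]$ its smallest segment length. **Estimator.** Let $c>1$, $\delta>0$. For each $n$ let $\mathcal I=\mathcal I_n$ be a $c$-normal system of intervals $[a,b)\subseteq[0,1)$: every interval $I\subseteq[0,1)$ with $|I|>c/n$ contains some $\tilde I\in\mathcal I$ with $|\tilde I|\ge|I|/c$; the end-points of the intervals in $\mathcal I$ lie on $\{i/n:0\le i\le n\}$; and all cells $[i/n,(i+1)/n)$ belong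 to $\mathcal I$. Let $s_I$, $I\in\mathcal I$, be penalties (deterministic or random, possibly depending on the data and on the candidate $g$) with $\sup_{I\in\mathcal I}|s_I|\le\delta\sqrt{\log n}$ almost surely (simultaneously for all candidates). Put $$T_{\mathcal I}(y;g)=\sup\Bigl\{\tfrac{1}{\sqrt{n|I|}}\Bigl|\sum_{i/n\in I}(y_i-v)\Bigr|-s_I:\ I\in\mathcal I,\ g\equiv v\text{ on }I\Bigr\},$$ and let $\hat f_n$ be almost surely any minimizer of $\#J(g)$ over $g\in\mathcal S$ subject to $T_{\mathcal I}(y^n;g)\le\eta_n$. The threshold is one of the following, for some $r>0$: * (A) $\eta_n=a\sqrt{\log n}$ with $a>\delta+\sigma\sqrt{2r+4}$; * (B) $\eta_n$ is the $(1-\beta_n)$-quantile of $T_{\mathcal I}(\xi^n;0)$, where $\beta_n\in(0,1)$, $\beta_n=O(n^{-r})$ and $n^{-R}=O(\beta_n)$ for some $R$; in this case the penalties $s_I$ do not depend on the candidate, and the same $s_I$ enter $T_{\mathcal I}(y^n;\cdot)$ and $T_{\mathcal I}(\xi^n;0)$. **Proposition.** If $\lim_{n\to\infty}\dfrac{k_n\log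 n}{\lambda_n\Delta_n^2 n}=0$, then there is a constant $C>0$ such that $$\lim_{n\to\infty}\mathbb P\Bigl\{\#J(\hat f_n)=\#J(f_n),\ \max_{\tau\in J(f_n)}\min_{\hat\tau\in J(\hat f_n)}|\tau-\hat\tau|\le C\,\frac{k_n\log n}{\Delta_n^2 n}\Bigr\}=1$$ (with $\max\emptyset=0$, $\min\emptyset=\infty$). In case (A), $C$ depends only on $c$, on $\eta$ (that is, on $a$) and on the sequence $(k_n)$; in case (B), only on $c$, $\delta$ and the sequences $(\eta_n)$ and $(k_n)$. -/

import Mathlib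

open MeasureTheory ProbabilityTheory Filter Topology
open scoped ENNReal NNReal

noncomputable section

namespace Multiscale

/-- Right-continuous step functions on `[0,1)` with finitely many jumps, in canonical form
`f = ∑ i, val i • 1_[τ i, τ (i+1))` with `0 = τ 0 < ⋯ < τ (k+1) = 1` and consecutive values
distinct; `k = 0` gives the constants. -/
structure Step where
  k : ℕ
  τ : Fin (k + 2) → ℝ
  val : Fin (k + 1) → ℝ
  τ_strictMono : StrictMono τ
  τ_zero : τ 0 = 0
  τ_last : τ (Fin.last (k + 1)) = 1
  val_ne : ∀ i : Fin k, val i.castSucc ≠ val i.succ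

namespace Step

/-- The function `[0,1) → ℝ` itself (extended by `0` to the real line). -/
def eval (f : Step) (x : ℝ) : ℝ :=
  ∑ i : Fin (f.k + 1),
    (Set.Ico (f.τ i.castSucc) (f.τ i.succ)).indicator (fun _ => f.val i) x

/-- The set of change-points `J(f) = {τ 1, …, τ k}`. -/
def jumps (f : Step) : Finset ℝ :=
  Finset.univ.image (fun i : Fin f.k => f.τ i.succ.castSucc)

/-- Smallest jump size; a constant function has no jump and the infimum is `∞`. -/
def minJump (f : Step) : ℝ≥0∞ :=
  ⨅ i : Fin f.k, ENNReal.ofReal |f.val i.succ - f.val i.castSucc|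

/-- Smallest segment length. -/
def minSegment (f : Step) : ℝ≥0∞ :=
  ⨅ i : Fin (f.k + 1), ENNReal.ofReal (f.τ i.succ - f.τ i.castSucc)

/-- The function `0`. -/
def zero : Step where
  k := 0
  τ := fun i => (i : ℕ)
  val := fun _ => 0
  τ_strictMono := fun i j h => Nat.cast_lt.mpr h
  τ_zero := by simp
  τ_last := by simp
  val_ne := fun i => i.elim0

end Step

/-- The class `S_L(k)`: at most `k` jumps and `L^∞`-norm on `[0,1)` at most `L`. -/
def stepClass (L : ℝ) (k : ℕ) : Set Step :=
  {f | f.jumps.card ≤ k ∧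
    eLpNorm f.eval ⊤ (volume.restrict (Set.Ico (0 : ℝ) 1)) ≤ ENNReal.ofReal L}

/-- `max_{τ ∈ J} min_{τ' ∈ J'} |τ - τ'|`, with `max ∅ = 0` and `min ∅ = ∞`.  The first argument
is the estimated set `J'`, the second the true set `J`. -/
def oneSidedDist (J' J : Finset ℝ) : ℝ≥0∞ :=
  ⨆ τ ∈ J, ⨅ τ' ∈ J', ENNReal.ofReal |τ - τ'|

/-- An interval `[lo, hi)` with `0 ≤ lo < hi ≤ 1`. -/
structure Ivl where
  lo : ℝ
  hi : ℝ
  lo_nonneg : 0 ≤ lo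
  lo_lt_hi : lo < hi
  hi_le_one : hi ≤ 1

namespace Ivl

/-- The interval as a set. -/
def toSet (I : Ivl) : Set ℝ := Set.Ico I.lo I.hi

/-- Its length. -/
def length (I : Ivl) : ℝ := I.hi - I.lo

end Ivl

/-- `c`-normal systems of intervals for sample size `n`.  End-points lie on the grid `i / n`,
`0 ≤ i ≤ n`, where `1` belongs to the grid since the cell `[(n-1)/n, 1)` is in the system. -/
structure IsNormal (c : ℝ) (n : ℕ) (S : Set Ivl) : Prop where
  rich : ∀ I : Ivl, c / n < I.length →
    ∃ I' ∈ S, I'.toSet ⊆ I.toSet ∧ c⁻¹ * I.length ≤ I'.length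
  grid : ∀ I ∈ S, (∃ i : ℕ, i ≤ n ∧ I.lo = (i : ℝ) / n) ∧ (∃ j : ℕ, j ≤ n ∧ I.hi = (j : ℝ) / n)
  cells : ∀ i : Fin n, ∃ I ∈ S, I.lo = (i : ℝ) / n ∧ I.hi = ((i : ℝ) + 1) / n

/-- The multiscale statistic
`T(y; g) = sup { (n|I|)^(-1/2) |∑_{i/n ∈ I} (y_i - v)| - s_I : I ∈ S, g ≡ v on I }`,
with `sup ∅ = -∞`. -/
def T (n : ℕ) (S : Set Ivl) (s : Ivl → ℝ) (y : Fin n → ℝ) (g : Step) : EReal :=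
  open scoped Classical in
  ⨆ I ∈ S, ⨆ v : ℝ, ⨆ _ : ∀ x ∈ I.toSet, g.eval x = v,
    ((1 / √(n * I.length) *
        |∑ i ∈ Finset.univ.filter (fun i : Fin n => (i : ℝ) / n ∈ I.toSet), (y i - v)|
      - s I : ℝ) : EReal)

/-- `g` solves: minimise the number of jumps over all step functions subject to
`T(y; g) ≤ η`.  The penalty `s` may depend on the candidate. -/
structure IsSolution (n : ℕ) (S : Set Ivl) (s : Step → Ivl → ℝ) (η : ℝ) (y : Fin n → ℝ)
    (g : Step) : Prop where
  feasible : T n S (s g) y g ≤ (η : EReal)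
  minimal : ∀ h : Step, T n S (s h) y h ≤ (η : EReal) → g.jumps.card ≤ h.jumps.card

variable {Ω : Type*} [MeasurableSpace Ω]

/-- Independent centred sub-Gaussian errors with scale parameter `σ`. -/
structure IsNoise (μ : Measure Ω) (σ : ℝ≥0) {n : ℕ} (ξ : Fin n → Ω → ℝ) : Prop where
  measurable : ∀ i, Measurable (ξ i)
  indep : iIndepFun ξ μ
  centred : ∀ i, ∫ ω, ξ i ω ∂μ = 0
  subgaussian : ∀ i, HasSubgaussianMGF (ξ i) (σ ^ 2) μ

/-- Observations `y_i = n ∫_{[i/n,(i+1)/n)} f + ξ_i`. -/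
def obs {n : ℕ} (f : Step) (ξ : Fin n → Ω → ℝ) (ω : Ω) (i : Fin n) : ℝ :=
  n * (∫ x in Set.Ico ((i : ℝ) / n) (((i : ℝ) + 1) / n), f.eval x) + ξ i ω

/-- The regression model with truth `f n ∈ S_L(k n)`, and `fhat` a multiscale change-point
segmentation estimator with constants `c`, `δ`, interval systems `S n`, thresholds `η n` and
(possibly random, data- and candidate-dependent) penalties `s n`. -/
structure IsSegmentation (μ : Measure Ω) (c δ L : ℝ) (σ : ℝ≥0) (k : ℕ → ℕ) (η : ℕ → ℝ)
    (ξ : (n : ℕ) → Fin n → Ω → ℝ) (f : ℕ → Step) (S : ℕ → Set Ivl)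
    (s : ℕ → Ω → Step → Ivl → ℝ) (fhat : ℕ → Ω → Step) : Prop where
  noise : ∀ n, 1 ≤ n → IsNoise μ σ (ξ n)
  truth : ∀ n, 1 ≤ n → f n ∈ stepClass L (k n)
  normal : ∀ n, 1 ≤ n → IsNormal c n (S n)
  penalty : ∀ n, 1 ≤ n → ∀ᵐ ω ∂μ, ∀ g : Step, ∀ I ∈ S n, |s n ω g I| ≤ δ * √(Real.log n)
  solution : ∀ n, 1 ≤ n → ∀ᵐ ω ∂μ,
    IsSolution n (S n) (s n ω) (η n) (obs (f n) (ξ n) ω) (fhat n ω)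

/-- `k_n log n / (λ_n Δ_n² n) → 0`. -/
def RatioVanishes (k : ℕ → ℕ) (f : ℕ → Step) : Prop :=
  Tendsto (fun n : ℕ => ENNReal.ofReal (k n * Real.log n) /
    ((f n).minSegment * (f n).minJump ^ 2 * n)) atTop (𝓝 0)

/-- With probability tending to one, the number of jumps is correct and the distance of the
change-points is at most `C k_n log n / (Δ_n² n)`.  It is expressed through the probability of
the complement, so that nothing is lost for a non-measurable choice of the solution. -/
def Consistent (μ : Measure Ω) (k : ℕ → ℕ) (f : ℕ → Step) (fhat : ℕ → Ω → Step) (C : ℝ) :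
    Prop :=
  Tendsto (fun n : ℕ => μ {ω | ¬ ((fhat n ω).jumps.card = (f n).jumps.card ∧
    oneSidedDist (fhat n ω).jumps (f n).jumps ≤
      ENNReal.ofReal (C * (k n * Real.log n)) / ((f n).minJump ^ 2 * n))}) atTop (𝓝 0)

/-- `q` is the `(1-β)`-quantile of `X`: the least `t` with `P(X > t) ≤ β`. -/
def IsUpperQuantile (μ : Measure Ω) (X : Ω → EReal) (β q : ℝ) : Prop :=
  IsLeast {t : ℝ | μ {ω | (t : EReal) < X ω} ≤ ENNReal.ofReal β} q

end Multiscale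

end

open Multiscale

/-! If truth and estimator both satisfy the multiscale constraint, then on every interval `I` of the
system where both are constant their values differ by at most a multiple of `√(log n / (n|I|))`
(`abs_sub_le_of_feasible`). An estimator without a jump within `ε ≍ log n / (Δ_n² n)` of a true jump
would be constant across it, with a value less than `Δ_n / 2` from the true values on both sides,
which is absurd (`exists_jump_near`). As `2ε ≤ λ_n`, different true jumps attract different
estimated ones, so the estimator has at least as many jumps as the truth (`card_jumps_le`);
minimality gives the converse.

It remains to see that the truth is feasible with probability tending to one. Its statistic is
dominated by that of pure noise (`T_obs_le_T_zero`), which is controlled by a sub-Gaussian union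
bound over grid intervals in case (A) and by the definition of the quantile in case (B). -/

namespace Multiscale

/-! ### Step functions: segments, jumps and values. -/

namespace Step

lemma eval_eq (f : Step) (i : Fin (f.k + 1)) {x : ℝ}
    (hx : x ∈ Set.Ico (f.τ i.castSucc) (f.τ i.succ)) : f.eval x = f.val i := by
  unfold eval
  rw [Finset.sum_eq_single i, Set.indicator_of_mem hx]
  · intro j _ hj
    refine Set.indicator_of_notMem (fun hx' => ?_) _
    rcases lt_or_gt_of_ne hj with h | h
    · have : f.τ j.succ ≤ f.τ i.castSucc :=
        f.τ_strictMono.monotone (by simp only [Fin.le_def, Fin.val_succ, Fin.val_castSucc]; omega)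
      linarith [hx.1, hx'.2]
    · have : f.τ i.succ ≤ f.τ j.castSucc :=
        f.τ_strictMono.monotone (by simp only [Fin.le_def, Fin.val_succ, Fin.val_castSucc]; omega)
      linarith [hx.2, hx'.1]
  · simp

lemma exists_segment (f : Step) {x : ℝ} (h0 : 0 ≤ x) (h1 : x < 1) :
    ∃ i : Fin (f.k + 1), x ∈ Set.Ico (f.τ i.castSucc) (f.τ i.succ) := by
  by_contra! h
  have key : ∀ j : Fin (f.k + 2), f.τ j ≤ x := by
    intro j
    induction j using Fin.induction with
    | zero => rw [f.τ_zero]; exact h0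
    | succ i ih => exact not_lt.1 fun hlt => h i ⟨ih, hlt⟩
  have := key (Fin.last _)
  rw [f.τ_last] at this
  linarith

lemma mem_jumps (f : Step) {x : ℝ} : x ∈ f.jumps ↔ ∃ i : Fin f.k, f.τ i.succ.castSucc = x := by
  simp [jumps]

lemma const_of_no_jumps (f : Step) {a b : ℝ} (ha : 0 ≤ a) (hab : a < b) (hb : b ≤ 1)
    (h : ∀ x ∈ f.jumps, x ∉ Set.Ioo a b) : ∃ v, ∀ x ∈ Set.Ico a b, f.eval x = v := by
  obtain ⟨i, hi⟩ := f.exists_segment ha (hab.trans_le hb)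
  -- The segment containing `a` reaches `b`: otherwise its right end is either `1 ≥ b` or a jump
  -- inside `(a, b)`.
  have hbi : b ≤ f.τ i.succ := by
    by_contra! hlt
    induction i using Fin.lastCases with
    | last =>
      rw [Fin.succ_last, f.τ_last] at hlt
      linarith
    | cast i =>
      rw [Fin.succ_castSucc] at hi hlt
      exact h _ (f.mem_jumps.2 ⟨i, rfl⟩) ⟨hi.2, hlt⟩
  exact ⟨f.val i, fun x hx => f.eval_eq i ⟨hi.1.trans hx.1, hx.2.trans_le hbi⟩⟩

/-- A real version of the smallest segment length. -/
lemma exists_minSegment (f : Step) : ∃ l : ℝ, 0 < l ∧ f.minSegment = ENNReal.ofReal l ∧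
    ∀ i : Fin (f.k + 1), l ≤ f.τ i.succ - f.τ i.castSucc := by
  have hpos : ∀ i : Fin (f.k + 1), 0 < f.τ i.succ - f.τ i.castSucc := fun i =>
    sub_pos.2 (f.τ_strictMono i.castSucc_lt_succ)
  obtain ⟨i, hi⟩ := exists_eq_ciInf_of_finite
    (f := fun i : Fin (f.k + 1) => ENNReal.ofReal (f.τ i.succ - f.τ i.castSucc))
  refine ⟨_, hpos i, hi.symm, fun j => ?_⟩
  rw [← ENNReal.ofReal_le_ofReal_iff (hpos j).le, hi]
  exact iInf_le _ j

/-- A real version of the smallest jump size. -/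
lemma exists_minJump (f : Step) (hf : 0 < f.k) : ∃ d : ℝ, 0 < d ∧ f.minJump = ENNReal.ofReal d ∧
    (∀ i : Fin f.k, d ≤ |f.val i.succ - f.val i.castSucc|) ∧
    ∃ i : Fin f.k, d = |f.val i.succ - f.val i.castSucc| := by
  have : Nonempty (Fin f.k) := ⟨⟨0, hf⟩⟩
  obtain ⟨i, hi⟩ := exists_eq_ciInf_of_finite
    (f := fun i : Fin f.k => ENNReal.ofReal |f.val i.succ - f.val i.castSucc|)
  refine ⟨_, abs_pos.2 (sub_ne_zero.2 (f.val_ne i).symm), hi.symm, fun j => ?_, i, rfl⟩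
  rw [← ENNReal.ofReal_le_ofReal_iff (abs_nonneg _), hi]
  exact iInf_le _ j

lemma tau_mem_Icc (f : Step) (j : Fin (f.k + 2)) : f.τ j ∈ Set.Icc (0 : ℝ) 1 :=
  ⟨f.τ_zero ▸ f.τ_strictMono.monotone (Fin.zero_le j),
    f.τ_last ▸ f.τ_strictMono.monotone (Fin.le_last j)⟩

/-- Every segment has positive measure, so the almost sure bound holds at some point of it. -/
lemma abs_val_le (f : Step) {L : ℝ} (hL : 0 ≤ L)
    (h : eLpNorm f.eval ⊤ (volume.restrict (Set.Ico (0 : ℝ) 1)) ≤ ENNReal.ofReal L)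
    (i : Fin (f.k + 1)) : |f.val i| ≤ L := by
  have hae : ∀ᵐ x ∂(volume.restrict (Set.Ico (0 : ℝ) 1)), ‖f.eval x‖ₑ ≤ ENNReal.ofReal L := by
    rw [eLpNorm_exponent_top] at h
    filter_upwards [ae_le_eLpNormEssSup (f := f.eval)] with x hx using hx.trans h
  have hsub : Set.Ico (f.τ i.castSucc) (f.τ i.succ) ⊆ Set.Ico (0 : ℝ) 1 :=
    Set.Ico_subset_Ico (f.tau_mem_Icc _).1 (f.tau_mem_Icc _).2
  have hae' := ae_restrict_of_ae_restrict_of_subset hsub hae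
  have hne : (volume.restrict (Set.Ico (f.τ i.castSucc) (f.τ i.succ))) ≠ 0 := by
    rw [Ne, Measure.restrict_eq_zero, Real.volume_Ico, ENNReal.ofReal_eq_zero, not_le]
    exact sub_pos.2 (f.τ_strictMono i.castSucc_lt_succ)
  have : (ae (volume.restrict (Set.Ico (f.τ i.castSucc) (f.τ i.succ)))).NeBot := ae_neBot.2 hne
  obtain ⟨x, hx, hxi⟩ := (hae'.and (ae_restrict_mem measurableSet_Ico)).exists
  rw [f.eval_eq i hxi, ← ofReal_norm, ENNReal.ofReal_le_ofReal_iff hL,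
    Real.norm_eq_abs] at hx
  exact hx

lemma minJump_le_of_mem_stepClass (f : Step) {L : ℝ} (hL : 0 ≤ L) {m : ℕ} (h : f ∈ stepClass L m)
    (i : Fin f.k) : |f.val i.succ - f.val i.castSucc| ≤ 2 * L := by
  have h1 := f.abs_val_le hL h.2 i.succ
  have h2 := f.abs_val_le hL h.2 i.castSucc
  linarith [abs_sub (f.val i.succ) (f.val i.castSucc)]

lemma eval_zero {x : ℝ} (hx : x ∈ Set.Ico (0 : ℝ) 1) : zero.eval x = 0 := by
  obtain ⟨i, hi⟩ := zero.exists_segment hx.1 hx.2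
  rw [zero.eval_eq i hi]
  rfl

end Step

/-! ### Deterministic consequences of the multiscale constraint. -/

open scoped Classical in
lemma T_le_iff {n : ℕ} {S : Set Ivl} {s : Ivl → ℝ} {y : Fin n → ℝ} {g : Step} {t : ℝ} :
    T n S s y g ≤ (t : EReal) ↔ ∀ I ∈ S, ∀ v : ℝ, (∀ x ∈ I.toSet, g.eval x = v) →
      1 / √(n * I.length) *
        |∑ i ∈ Finset.univ.filter (fun i : Fin n => (i : ℝ) / n ∈ I.toSet), (y i - v)|
      - s I ≤ t := by
  simp only [T, iSup_le_iff, EReal.coe_le_coe_iff]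

lemma Ivl.left_mem (I : Ivl) : I.lo ∈ I.toSet := ⟨le_rfl, I.lo_lt_hi⟩

lemma Ivl.toSet_subset (I : Ivl) : I.toSet ⊆ Set.Ico 0 1 :=
  Set.Ico_subset_Ico I.lo_nonneg I.hi_le_one

lemma Ivl.length_pos (I : Ivl) : 0 < I.length := sub_pos.2 I.lo_lt_hi

lemma card_filter_Ico_fin {n p q : ℕ} (hq : q ≤ n) :
    (Finset.univ.filter (fun i : Fin n => p ≤ (i : ℕ) ∧ (i : ℕ) < q)).card = q - p := by
  rw [← Nat.card_Ico, ← Finset.card_map Fin.valEmbedding]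
  congr 1
  ext j
  simp only [Finset.mem_map, Finset.mem_filter, Finset.mem_univ, true_and, Fin.valEmbedding_apply,
    Finset.mem_Ico]
  exact ⟨by rintro ⟨i, hi, rfl⟩; exact hi, fun h => ⟨⟨j, by omega⟩, h, rfl⟩⟩

lemma div_mem_Ico_iff {n p q : ℕ} (hn : 0 < n) {i : ℕ} :
    (i : ℝ) / n ∈ Set.Ico ((p : ℝ) / n) ((q : ℝ) / n) ↔ p ≤ i ∧ i < q := by
  have hn' : (0 : ℝ) < n := Nat.cast_pos.2 hn
  rw [Set.mem_Ico, div_le_div_iff_of_pos_right hn', div_lt_div_iff_of_pos_right hn']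
  norm_cast

open scoped Classical in
/-- The sample indices and the length of an interval with end-points on the grid. -/
lemma IsNormal.exists_grid {c : ℝ} {n : ℕ} {S : Set Ivl} (hS : IsNormal c n S) (hn : 0 < n)
    {I : Ivl} (hI : I ∈ S) : ∃ p q : ℕ, p < q ∧ q ≤ n ∧ I.lo = (p : ℝ) / n ∧ I.hi = (q : ℝ) / n ∧
      n * I.length = ((q - p : ℕ) : ℝ) ∧
      (Finset.univ.filter (fun i : Fin n => (i : ℝ) / n ∈ I.toSet)) =
        Finset.univ.filter (fun i : Fin n => p ≤ (i : ℕ) ∧ (i : ℕ) < q) := by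
  obtain ⟨⟨p, hp, hlo⟩, ⟨q, hq, hhi⟩⟩ := hS.grid I hI
  have hn' : (0 : ℝ) < n := Nat.cast_pos.2 hn
  have hpq : p < q := by
    have := I.lo_lt_hi
    rw [hlo, hhi, div_lt_div_iff_of_pos_right hn'] at this
    exact_mod_cast this
  refine ⟨p, q, hpq, hq, hlo, hhi, ?_, ?_⟩
  · rw [Ivl.length, hlo, hhi, Nat.cast_sub hpq.le]
    field_simp
  · ext i
    simp only [Finset.mem_filter, Finset.mem_univ, true_and, Ivl.toSet, hlo, hhi]
    exact div_mem_Ico_iff hn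

open scoped Classical in
lemma IsNormal.card_filter {c : ℝ} {n : ℕ} {S : Set Ivl} (hS : IsNormal c n S) (hn : 0 < n)
    {I : Ivl} (hI : I ∈ S) :
    ((Finset.univ.filter (fun i : Fin n => (i : ℝ) / n ∈ I.toSet)).card : ℝ) = n * I.length := by
  obtain ⟨p, q, hpq, hq, -, -, hlen, hfil⟩ := hS.exists_grid hn hI
  rw [hlen, hfil, card_filter_Ico_fin hq]

open scoped Classical in
/-- Two candidates satisfying the multiscale constraint differ little on an interval of the
system on which both are constant. -/
lemma abs_sub_le_of_feasible {c : ℝ} {n : ℕ} {S : Set Ivl} (hS : IsNormal c n S) (hn : 0 < n)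
    {s s' : Ivl → ℝ} {b η : ℝ} {y : Fin n → ℝ} {f g : Step}
    (hs : ∀ I ∈ S, |s I| ≤ b) (hs' : ∀ I ∈ S, |s' I| ≤ b)
    (hf : T n S s y f ≤ (η : EReal)) (hg : T n S s' y g ≤ (η : EReal)) {I : Ivl} (hI : I ∈ S)
    {u v : ℝ} (hu : ∀ x ∈ I.toSet, f.eval x = u) (hv : ∀ x ∈ I.toSet, g.eval x = v) :
    √(n * I.length) * |u - v| ≤ 2 * (η + b) := by
  have h1 := T_le_iff.1 hf I hI u hu
  have h2 := T_le_iff.1 hg I hI v hv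
  have h3 := (le_abs_self _).trans (hs I hI)
  have h4 := (le_abs_self _).trans (hs' I hI)
  have hm : 0 < n * I.length := mul_pos (Nat.cast_pos.2 hn) I.length_pos
  have hr := Real.sqrt_pos.2 hm
  have hrr : √(n * I.length) * √(n * I.length) = n * I.length := Real.mul_self_sqrt hm.le
  have hcard := hS.card_filter hn hI
  set A := Finset.univ.filter (fun i : Fin n => (i : ℝ) / n ∈ I.toSet)
  have hdiff : n * I.length * |u - v| ≤
      |∑ i ∈ A, (y i - v)| + |∑ i ∈ A, (y i - u)| := by
    have : ∑ i ∈ A, (y i - v) - ∑ i ∈ A, (y i - u) = n * I.length * (u - v) := by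
      rw [← Finset.sum_sub_distrib, Finset.sum_congr rfl
        (fun i _ => (by ring : y i - v - (y i - u) = u - v)), Finset.sum_const, nsmul_eq_mul, hcard]
    have h := abs_sub (∑ i ∈ A, (y i - v)) (∑ i ∈ A, (y i - u))
    rwa [this, abs_mul, abs_of_pos hm] at h
  have h5 : 1 / √(n * I.length) * (n * I.length * |u - v|) = √(n * I.length) * |u - v| := by
    nth_rw 2 [← hrr]
    field_simp
  have h6 := mul_le_mul_of_nonneg_left hdiff (one_div_pos.2 hr).le
  rw [h5, mul_add] at h6
  linarith

/-- If the truth and a candidate satisfy the multiscale constraint, then every change-point of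
the truth is close to a change-point of the candidate. -/
lemma exists_jump_near {c : ℝ} (hc : 0 < c) {n : ℕ} {S : Set Ivl} (hS : IsNormal c n S)
    (hn : 0 < n) {s s' : Ivl → ℝ} {b η M ε d : ℝ} {y : Fin n → ℝ} {f g : Step}
    (hs : ∀ I ∈ S, |s I| ≤ b) (hs' : ∀ I ∈ S, |s' I| ≤ b)
    (hf : T n S s y f ≤ (η : EReal)) (hg : T n S s' y g ≤ (η : EReal))
    (hM : η + b ≤ M) (hd : 0 < d) (hdle : ∀ i : Fin f.k, d ≤ |f.val i.succ - f.val i.castSucc|)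
    (hε : c / n < ε) (hseg : ∀ i : Fin (f.k + 1), ε ≤ f.τ i.succ - f.τ i.castSucc)
    (hbig : 16 * c * M ^ 2 < n * ε * d ^ 2) :
    ∀ x ∈ f.jumps, ∃ x' ∈ g.jumps, |x - x'| < ε := by
  intro x hx
  obtain ⟨i, rfl⟩ := f.mem_jumps.1 hx
  set x := f.τ i.succ.castSucc
  by_contra! hno
  have hn' : (0 : ℝ) < n := Nat.cast_pos.2 hn
  have hε0 : 0 < ε := (div_pos hc hn').trans hε
  have hl := hseg i.castSucc
  rw [Fin.succ_castSucc] at hl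
  have hr := hseg i.succ
  have hl0 := (f.tau_mem_Icc i.castSucc.castSucc).1
  have hr1 := (f.tau_mem_Icc i.succ.succ).2
  obtain ⟨v, hv⟩ := g.const_of_no_jumps (a := x - ε) (b := x + ε) (by linarith) (by linarith)
    (by linarith) (fun x' hx' hmem => by
      have := hno x' hx'
      rw [le_abs] at this
      rcases this with h | h <;> linarith [hmem.1, hmem.2])
  -- Normality yields `I ⊆ J` in the system with `ε ≤ c|I|`. If `|u - v| ≥ d / 2`, squaring `√(n|I|)
  -- d / 2 ≤ 2M` gives `n ε d² ≤ 16 c M²`, against `hbig`.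
  have key : ∀ (J : Ivl) (u : ℝ), J.length = ε → J.toSet ⊆ Set.Ico (x - ε) (x + ε) →
      (∀ z ∈ J.toSet, f.eval z = u) → |u - v| < d / 2 := by
    intro J u hJ hJs hJu
    obtain ⟨I, hI, hIJ, hlen⟩ := hS.rich J (hJ ▸ hε)
    have h1 := abs_sub_le_of_feasible hS hn hs hs' hf hg hI (fun z hz => hJu z (hIJ hz))
      (fun z hz => hv z (hJs (hIJ hz)))
    by_contra! hcon
    have hm : 0 ≤ n * I.length := (mul_pos hn' I.length_pos).le
    have h2 : √(n * I.length) * (d / 2) ≤ 2 * M :=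
      (mul_le_mul_of_nonneg_left hcon (Real.sqrt_nonneg _)).trans (h1.trans (by linarith))
    have h3 := pow_le_pow_left₀ (by positivity) h2 2
    rw [mul_pow, Real.sq_sqrt hm] at h3
    have h4 : ε ≤ c * I.length := by
      rw [hJ, inv_mul_le_iff₀ hc] at hlen
      exact hlen
    have h5 : n * ε * d ^ 2 ≤ c * (n * I.length * d ^ 2) := by
      have := mul_le_mul_of_nonneg_left h4 (by positivity : 0 ≤ n * d ^ 2)
      linarith
    have h6 := mul_le_mul_of_nonneg_left h3 hc.le
    linarith
  -- Used on both sides of `x`, the bound contradicts a jump of size at least `d`.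
  have k1 := key ⟨x - ε, x, by linarith, by linarith, by linarith⟩ (f.val i.castSucc)
    (by simp [Ivl.length]) (Set.Ico_subset_Ico le_rfl (by simpa using hε0.le))
    (fun z hz => f.eval_eq _ ⟨by linarith [hz.1], hz.2⟩)
  have k2 := key ⟨x, x + ε, by linarith, by linarith, by linarith⟩ (f.val i.succ)
    (by simp [Ivl.length]) (Set.Ico_subset_Ico (by linarith) le_rfl)
    (fun z hz => f.eval_eq _ ⟨hz.1, hz.2.trans_le (by linarith)⟩)
  have k3 := hdle i
  have := abs_sub_le (f.val i.succ) v (f.val i.castSucc)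
  rw [abs_sub_comm v] at this
  linarith

/-- Jumps of `f` are at least `2ε` apart, so no jump of `g` is within `ε` of two of them: choosing a
near jump is injective. -/
lemma card_jumps_le {f g : Step} {ε : ℝ} (hseg : ∀ i : Fin (f.k + 1), 2 * ε ≤
    f.τ i.succ - f.τ i.castSucc) (h : ∀ x ∈ f.jumps, ∃ x' ∈ g.jumps, |x - x'| < ε) :
    f.jumps.card ≤ g.jumps.card := by
  choose! φ hφ hφε using h
  refine Finset.card_le_card_of_injOn φ hφ ?_
  have aux : ∀ i j : Fin f.k, i < j → φ (f.τ i.succ.castSucc) ≠ φ (f.τ j.succ.castSucc) := by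
    intro i j hij heq
    have h1 := hφε _ (f.mem_jumps.2 ⟨i, rfl⟩)
    have h2 := hφε _ (f.mem_jumps.2 ⟨j, rfl⟩)
    rw [← heq] at h2
    rw [abs_lt] at h1 h2
    have h3 := hseg i.succ
    have h4 : f.τ i.succ.succ ≤ f.τ j.succ.castSucc :=
      f.τ_strictMono.monotone (by
        simp only [Fin.le_def, Fin.val_succ, Fin.val_castSucc]; exact Nat.succ_le_succ hij)
    linarith
  intro x hx x' hx' heq
  obtain ⟨i, rfl⟩ := f.mem_jumps.1 hx
  obtain ⟨j, rfl⟩ := f.mem_jumps.1 hx'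
  rcases lt_trichotomy i j with hij | rfl | hij
  · exact absurd heq (aux i j hij)
  · rfl
  · exact absurd heq.symm (aux j i hij)

open scoped Classical in
lemma T_zero_le {n : ℕ} {S : Set Ivl} {s : Ivl → ℝ} {b t : ℝ} {y : Fin n → ℝ}
    (hs : ∀ I ∈ S, |s I| ≤ b)
    (h : ∀ I ∈ S, 1 / √(n * I.length) *
      |∑ i ∈ Finset.univ.filter (fun i : Fin n => (i : ℝ) / n ∈ I.toSet), y i| ≤ t) :
    T n S s y Step.zero ≤ ((t + b : ℝ) : EReal) := by
  rw [T_le_iff]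
  intro I hI v hv
  have hv0 : v = 0 := by
    rw [← hv _ I.left_mem, Step.eval_zero (I.toSet_subset I.left_mem)]
  subst hv0
  simp only [sub_zero]
  linarith [h I hI, (abs_le.1 (hs I hI)).1]

lemma obs_sub_eq {Ω : Type*} [MeasurableSpace Ω] {n p q : ℕ} (hn : 0 < n) {f : Step}
    {ξ : Fin n → Ω → ℝ} {ω : Ω} {v : ℝ}
    (hv : ∀ x ∈ Set.Ico ((p : ℝ) / n) ((q : ℝ) / n), f.eval x = v) {i : Fin n}
    (hi : p ≤ (i : ℕ) ∧ (i : ℕ) < q) : obs f ξ ω i - v = ξ i ω := by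
  have hn' : (0 : ℝ) < n := Nat.cast_pos.2 hn
  have h1 : (p : ℝ) ≤ (i : ℕ) := by exact_mod_cast hi.1
  have h2 : ((i : ℕ) : ℝ) + 1 ≤ q := by exact_mod_cast hi.2
  have hsub : Set.Ico (((i : ℕ) : ℝ) / n) ((((i : ℕ) : ℝ) + 1) / n) ⊆
      Set.Ico ((p : ℝ) / n) ((q : ℝ) / n) :=
    Set.Ico_subset_Ico (by gcongr) (by gcongr)
  have hlen : (((i : ℕ) : ℝ) + 1) / n - ((i : ℕ) : ℝ) / n = 1 / n := by ring
  rw [obs, setIntegral_congr_fun measurableSet_Ico (fun x hx => hv x (hsub hx)), setIntegral_const,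
    Measure.real, Real.volume_Ico, hlen, ENNReal.toReal_ofReal (by positivity), smul_eq_mul]
  field_simp
  ring

-- Where `f` equals `v`, the residual is exactly the noise; and `0` is constant on every interval,
-- so the right-hand supremum runs over more intervals, with the same penalties.
open scoped Classical in
lemma T_obs_le_T_zero {Ω : Type*} [MeasurableSpace Ω] {c : ℝ} {n : ℕ} {S : Set Ivl}
    (hS : IsNormal c n S) (hn : 0 < n) (s : Ivl → ℝ) (f : Step) (ξ : Fin n → Ω → ℝ) (ω : Ω) :
    T n S s (obs f ξ ω) f ≤ T n S s (fun i => ξ i ω) Step.zero := by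
  refine iSup₂_le fun I hI => iSup₂_le fun v hv => ?_
  refine le_iSup₂_of_le I hI (le_iSup₂_of_le 0
    (fun x hx => Step.eval_zero (I.toSet_subset hx)) (EReal.coe_le_coe_iff.2 (le_of_eq ?_)))
  obtain ⟨p, q, -, -, hlo, hhi, -, -⟩ := hS.exists_grid hn hI
  rw [Ivl.toSet, hlo, hhi] at hv
  congr 3
  refine Finset.sum_congr rfl fun i hi => ?_
  have hi' := (Finset.mem_filter.1 hi).2
  rw [Ivl.toSet, hlo, hhi, div_mem_Ico_iff hn] at hi'
  rw [obs_sub_eq hn hv hi', sub_zero]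

/-! ### Sub-Gaussian bounds for the noise statistic. -/

variable {Ω : Type*} [MeasurableSpace Ω] {μ : Measure Ω}

/-- The sum is sub-Gaussian with variance proxy `|A| σ²`, so the normalisation by `√|A|` makes the
Chernoff bound independent of `A`. -/
lemma IsNoise.measure_abs_sum_ge_le {σ : ℝ≥0} {n : ℕ} {ξ : Fin n → Ω → ℝ}
    (h : IsNoise μ σ ξ) [IsProbabilityMeasure μ] (hσ : 0 < σ) (A : Finset (Fin n))
    (hA : A.Nonempty) {t : ℝ} (ht : 0 ≤ t) :
    μ {ω | t * √(A.card : ℝ) ≤ |∑ i ∈ A, ξ i ω|} ≤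
      ENNReal.ofReal (2 * Real.exp (-t ^ 2 / (2 * σ ^ 2))) := by
  have hsum := HasSubgaussianMGF.sum_of_iIndepFun h.indep (s := A) (fun i _ => h.subgaussian i)
  have hcard : (0 : ℝ) < A.card := Nat.cast_pos.2 hA.card_pos
  have hσ' : (0 : ℝ) < σ := hσ
  have hexp : -(t * √(A.card : ℝ)) ^ 2 / (2 * ((∑ _i ∈ A, σ ^ 2 : ℝ≥0) : ℝ)) =
      -t ^ 2 / (2 * σ ^ 2) := by
    rw [mul_pow, Real.sq_sqrt hcard.le, Finset.sum_const, nsmul_eq_mul]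
    push_cast
    field_simp
  have h1 := hsum.measure_ge_le (mul_nonneg ht (Real.sqrt_nonneg (A.card : ℝ)))
  have h2 := hsum.neg.measure_ge_le (mul_nonneg ht (Real.sqrt_nonneg (A.card : ℝ)))
  rw [hexp] at h1 h2
  have hsub : {ω | t * √(A.card : ℝ) ≤ |∑ i ∈ A, ξ i ω|} ⊆
      {ω | t * √(A.card : ℝ) ≤ ∑ i ∈ A, ξ i ω} ∪
        {ω | t * √(A.card : ℝ) ≤ (-fun ω => ∑ i ∈ A, ξ i ω) ω} := by
    intro ω hω
    exact (le_abs (a := t * √(A.card : ℝ)) (b := ∑ i ∈ A, ξ i ω)).1 hω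
  rw [← ofReal_measureReal]
  refine ENNReal.ofReal_le_ofReal ?_
  calc _ ≤ _ := measureReal_mono hsub
    _ ≤ _ := measureReal_union_le _ _
    _ ≤ _ := by linarith

-- A union bound over at most `(n + 1)² ≤ 4n²` pairs of grid end-points.
open scoped Classical in
lemma IsNoise.measure_stat_gt_le {σ : ℝ≥0} {n : ℕ} {ξ : Fin n → Ω → ℝ}
    (h : IsNoise μ σ ξ) [IsProbabilityMeasure μ] (hσ : 0 < σ) {c : ℝ} {S : Set Ivl}
    (hS : IsNormal c n S) (hn : 0 < n) {t : ℝ} (ht : 0 ≤ t) :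
    μ {ω | ¬ ∀ I ∈ S, 1 / √(n * I.length) *
      |∑ i ∈ Finset.univ.filter (fun i : Fin n => (i : ℝ) / n ∈ I.toSet), ξ i ω| ≤ t} ≤
      ENNReal.ofReal (8 * n ^ 2 * Real.exp (-t ^ 2 / (2 * σ ^ 2))) := by
  set F : ℕ × ℕ → Finset (Fin n) := fun z =>
    Finset.univ.filter (fun i : Fin n => z.1 ≤ (i : ℕ) ∧ (i : ℕ) < z.2)
  set P : Finset (ℕ × ℕ) := (Finset.range (n + 1) ×ˢ Finset.range (n + 1)).filter
    (fun z => (F z).Nonempty)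
  have hsub : {ω | ¬ ∀ I ∈ S, 1 / √(n * I.length) *
      |∑ i ∈ Finset.univ.filter (fun i : Fin n => (i : ℝ) / n ∈ I.toSet), ξ i ω| ≤ t} ⊆
      ⋃ z ∈ P, {ω | t * √((F z).card : ℝ) ≤ |∑ i ∈ F z, ξ i ω|} := by
    intro ω hω
    simp only [Set.mem_ofPred_eq] at hω
    push Not at hω
    obtain ⟨I, hI, hlt⟩ := hω
    obtain ⟨p, q, hpq, hq, -, -, hlen, hfil⟩ := hS.exists_grid hn hI
    have hm : 0 < √(n * I.length) :=
      Real.sqrt_pos.2 (mul_pos (Nat.cast_pos.2 hn) I.length_pos)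
    rw [hfil, one_div_mul_eq_div, lt_div_iff₀ hm, hlen] at hlt
    simp only [Set.mem_iUnion]
    refine ⟨(p, q), ?_, ?_⟩
    · simp only [P, F, Finset.mem_filter, Finset.mem_product, Finset.mem_range]
      exact ⟨⟨by omega, by omega⟩, ⟨p, by omega⟩, by simp [hpq]⟩
    · simp only [Set.mem_ofPred_eq, F, card_filter_Ico_fin hq]
      exact hlt.le
  have hPcard : (P.card : ℝ) ≤ 4 * n ^ 2 := by
    have h1 : P.card ≤ (n + 1) * (n + 1) := by
      refine (Finset.card_filter_le _ _).trans ?_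
      rw [Finset.card_product, Finset.card_range]
    have h2 : (n + 1) * (n + 1) ≤ 4 * n ^ 2 := by nlinarith
    exact_mod_cast h1.trans h2
  calc _ ≤ _ := measure_mono hsub
    _ ≤ ∑ z ∈ P, μ {ω | t * √((F z).card : ℝ) ≤ |∑ i ∈ F z, ξ i ω|} :=
      measure_biUnion_finset_le _ _
    _ ≤ ∑ _z ∈ P, ENNReal.ofReal (2 * Real.exp (-t ^ 2 / (2 * σ ^ 2))) :=
      Finset.sum_le_sum fun z hz =>
        h.measure_abs_sum_ge_le hσ _ (Finset.mem_filter.1 hz).2 ht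
    _ = ENNReal.ofReal (P.card * (2 * Real.exp (-t ^ 2 / (2 * σ ^ 2)))) := by
      rw [Finset.sum_const, nsmul_eq_mul, ENNReal.ofReal_mul (Nat.cast_nonneg _),
        ENNReal.ofReal_natCast]
    _ ≤ _ := by
      refine ENNReal.ofReal_le_ofReal ?_
      have := mul_le_mul_of_nonneg_right hPcard
        (by positivity : 0 ≤ 2 * Real.exp (-t ^ 2 / (2 * σ ^ 2)))
      linarith

/-- The multiscale statistic of pure noise is `O(√(log n))` with polynomially high probability. -/
lemma IsNoise.measure_T_zero_gt_le {σ : ℝ≥0} {n : ℕ} {ξ : Fin n → Ω → ℝ}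
    (h : IsNoise μ σ ξ) [IsProbabilityMeasure μ] (hσ : 0 < σ) {c : ℝ} {S : Set Ivl}
    (hS : IsNormal c n S) (hn : 0 < n) {s : Ω → Ivl → ℝ} {δ A ρ : ℝ}
    (hs : ∀ᵐ ω ∂μ, ∀ I ∈ S, |s ω I| ≤ δ * √(Real.log n)) (hA : 0 ≤ A)
    (hAρ : σ ^ 2 * (2 * ρ + 4) ≤ A ^ 2) :
    μ {ω | (((A + δ) * √(Real.log n) : ℝ) : EReal) < T n S (s ω) (fun i => ξ i ω) Step.zero} ≤
      ENNReal.ofReal (8 * (n : ℝ) ^ (-ρ)) := by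
  classical
  have hn' : (0 : ℝ) < n := Nat.cast_pos.2 hn
  have hσ' : (0 : ℝ) < σ := hσ
  have hlog : 0 ≤ Real.log n := Real.log_natCast_nonneg n
  refine le_trans ?_ ((h.measure_stat_gt_le hσ hS hn
    (t := A * √(Real.log n)) (by positivity)).trans (ENNReal.ofReal_le_ofReal ?_))
  · refine measure_mono_ae ?_
    filter_upwards [hs] with ω hω hlt hle
    refine absurd (T_zero_le hω hle) (not_le.2 ?_)
    rw [← add_mul]
    exact hlt
  · rw [mul_pow, Real.sq_sqrt hlog, mul_assoc]
    -- Two of the `ρ + 2` powers of `n` pay for the union bound; hence the `2ρ + 4` in the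
    -- hypothesis.
    have h1 : -(A ^ 2 * Real.log n) / (2 * (σ : ℝ) ^ 2) ≤ Real.log n * (-ρ - 2) := by
      rw [div_le_iff₀ (by positivity)]
      nlinarith [mul_le_mul_of_nonneg_right hAρ hlog]
    have h2 : (n : ℝ) ^ 2 * (n : ℝ) ^ (-ρ - 2) = (n : ℝ) ^ (-ρ) := by
      rw [← Real.rpow_natCast, ← Real.rpow_add hn']
      congr 1
      push_cast
      ring
    rw [← h2, Real.rpow_def_of_pos hn' (-ρ - 2)]
    gcongr

/-! ### From feasibility of the truth to consistency. -/

/-- On the event that the truth is feasible, the estimator is as accurate as claimed. -/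
lemma accurate_of_feasible {c : ℝ} (hc : 1 < c) {n : ℕ} (hn : 2 ≤ n) {S : Set Ivl}
    (hS : IsNormal c n S) {s : Step → Ivl → ℝ} {δ η M C L : ℝ} (hL : 0 < L) {m : ℕ}
    {y : Fin n → ℝ} {f g : Step} (hfm : f ∈ stepClass L m)
    (hs : ∀ h : Step, ∀ I ∈ S, |s h I| ≤ δ * √(Real.log n))
    (hf : T n S (s f) y f ≤ (η : EReal)) (hg : IsSolution n S s η y g)
    (hM : η + δ * √(Real.log n) ≤ M * √(Real.log n)) (hC : 16 * c * M ^ 2 < C)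
    (hlog : c * (2 * L) ^ 2 < C * Real.log n)
    (hratio : ENNReal.ofReal (m * Real.log n) / (f.minSegment * f.minJump ^ 2 * n) <
      ENNReal.ofReal (1 / (2 * C))) :
    g.jumps.card = f.jumps.card ∧
      oneSidedDist g.jumps f.jumps ≤
        ENNReal.ofReal (C * (m * Real.log n)) / (f.minJump ^ 2 * n) := by
  have hle : g.jumps.card ≤ f.jumps.card := hg.minimal f hf
  rcases Nat.eq_zero_or_pos f.k with hk | hk
  · have hemp : f.jumps = ∅ := by
      rw [Finset.eq_empty_iff_forall_notMem]
      intro x hx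
      obtain ⟨i, -⟩ := f.mem_jumps.1 hx
      exact (hk ▸ i).elim0
    rw [hemp] at hle ⊢
    exact ⟨le_antisymm hle (by simp), by simp [oneSidedDist]⟩
  have hc0 : 0 < c := by linarith
  have hn0 : 0 < n := by omega
  have hn' : (0 : ℝ) < n := Nat.cast_pos.2 hn0
  have hlogpos : 0 < Real.log n := Real.log_pos (by exact_mod_cast hn)
  have hC0 : 0 < C := lt_of_le_of_lt (by positivity) hC
  obtain ⟨l, hl0, hl, hlseg⟩ := f.exists_minSegment
  obtain ⟨d, hd0, hd, hdle, i₀, hi₀⟩ := f.exists_minJump hk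
  have hd2L : d ≤ 2 * L := hi₀ ▸ f.minJump_le_of_mem_stepClass hL.le hfm i₀
  have hm1 : (1 : ℝ) ≤ m := by
    have h1 : 0 < f.jumps.card := Finset.card_pos.2 ⟨_, f.mem_jumps.2 ⟨⟨0, hk⟩, rfl⟩⟩
    exact_mod_cast h1.trans_le hfm.1
  have hmlog : Real.log n ≤ m * Real.log n := le_mul_of_one_le_left hlogpos.le hm1
  -- The localisation radius needs no factor `m`; the claimed rate follows from `1 ≤ m`.
  set ε := C * Real.log n / (d ^ 2 * n) with hε
  have hεseg : 2 * ε ≤ l := by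
    rw [hl, hd, ← ENNReal.ofReal_pow hd0.le, ← ENNReal.ofReal_mul hl0.le,
      ← ENNReal.ofReal_natCast n, ← ENNReal.ofReal_mul (by positivity),
      ← ENNReal.ofReal_div_of_pos (by positivity),
      ENNReal.ofReal_lt_ofReal_iff (by positivity), div_lt_div_iff₀ (by positivity)
        (by positivity)] at hratio
    rw [hε, ← mul_div_assoc, div_le_iff₀ (by positivity)]
    have := mul_le_mul_of_nonneg_right hmlog (by positivity : 0 ≤ 2 * C)
    linarith
  have hε0 : 0 < ε := by positivity
  -- Normality only speaks of intervals longer than `c / n`. The `L^∞` bound gives `d ≤ 2L`, so a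
  -- large `log n` suffices.
  have hcε : c / n < ε := by
    rw [hε, div_lt_div_iff₀ hn' (by positivity)]
    have : c * d ^ 2 < C * Real.log n :=
      lt_of_le_of_lt (mul_le_mul_of_nonneg_left (pow_le_pow_left₀ hd0.le hd2L 2) hc0.le) hlog
    have := mul_lt_mul_of_pos_right this hn'
    linarith
  have hbig : 16 * c * (M * √(Real.log n)) ^ 2 < n * ε * d ^ 2 := by
    have : n * ε * d ^ 2 = C * Real.log n := by
      rw [hε]
      field_simp
    rw [this, mul_pow, Real.sq_sqrt hlogpos.le, ← mul_assoc]
    exact mul_lt_mul_of_pos_right hC hlogpos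
  have hnear := exists_jump_near hc0 hS hn0 (hs f) (hs g) hf hg.feasible hM hd0 hdle hcε
    (fun i => by linarith [hlseg i]) hbig
  refine ⟨le_antisymm hle (card_jumps_le (fun i => hεseg.trans (hlseg i)) hnear), ?_⟩
  refine iSup₂_le fun x hx => ?_
  obtain ⟨x', hx', hlt⟩ := hnear x hx
  refine (iInf₂_le x' hx').trans ?_
  rw [hd, ← ENNReal.ofReal_pow hd0.le, ← ENNReal.ofReal_natCast n,
    ← ENNReal.ofReal_mul (by positivity), ← ENNReal.ofReal_div_of_pos (by positivity)]
  refine ENNReal.ofReal_le_ofReal (hlt.le.trans ?_)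
  rw [hε]
  gcongr

lemma tendsto_log_natCast : Tendsto (fun n : ℕ => Real.log n) atTop atTop :=
  Real.tendsto_log_atTop.comp tendsto_natCast_atTop_atTop

/-- For large `n` the bad event lies, up to a null set, in the event that the truth is infeasible.
The constant depends on `c` and `M` alone. -/
theorem IsSegmentation.consistent {c δ L : ℝ} {σ : ℝ≥0} {k : ℕ → ℕ} {η : ℕ → ℝ}
    {ξ : (n : ℕ) → Fin n → Ω → ℝ} {f : ℕ → Step} {S : ℕ → Set Ivl}
    {s : ℕ → Ω → Step → Ivl → ℝ} {fhat : ℕ → Ω → Step}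
    (h : IsSegmentation μ c δ L σ k η ξ f S s fhat) (hc : 1 < c) (hL : 0 < L) {M C : ℝ}
    (hM : ∀ᶠ n : ℕ in atTop, η n + δ * √(Real.log n) ≤ M * √(Real.log n))
    (hC : 16 * c * M ^ 2 < C) (hratio : RatioVanishes k f)
    (hfeas : Tendsto (fun n : ℕ => μ {ω | (η n : EReal) <
      T n (S n) (s n ω (f n)) (obs (f n) (ξ n) ω) (f n)}) atTop (𝓝 0)) :
    Consistent μ k f fhat C := by
  have hC0 : 0 < C := lt_of_le_of_lt (by positivity) hC
  refine tendsto_of_tendsto_of_tendsto_of_le_of_le' tendsto_const_nhds hfeas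
    (Eventually.of_forall fun _ => zero_le) ?_
  have hr := hratio.eventually_lt_const
    (ENNReal.ofReal_pos.2 (by positivity : 0 < 1 / (2 * C)))
  have hlog := (tendsto_log_natCast.const_mul_atTop hC0).eventually_gt_atTop (c * (2 * L) ^ 2)
  filter_upwards [hM, hr, hlog, eventually_ge_atTop 2] with n hMn hrn hlogn hn
  have hn1 : 1 ≤ n := by omega
  refine measure_mono_ae ?_
  filter_upwards [h.penalty n hn1, h.solution n hn1] with ω hp hsol hbad
  by_contra hle
  exact hbad (accurate_of_feasible hc hn (h.normal n hn1) hL (h.truth n hn1) hp (not_lt.1 hle)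
    hsol hMn hC hlogn hrn)

end Multiscale

/-! ### Choice of the constants for the two thresholds. -/

open Multiscale
theorem proposition1 :
    -- threshold `η = a √(log n)` with `a > δ + σ √(2 r + 4)`
    (∀ (c a : ℝ) (k : ℕ → ℕ), 1 < c → ∃ C : ℝ, 0 < C ∧
      ∀ (δ r L : ℝ) (σ : ℝ≥0), 0 < δ → 0 < r → 0 < L → 0 < σ → δ + σ * √(2 * r + 4) < a →
      ∀ (Ω : Type*) [MeasurableSpace Ω] (μ : Measure Ω) [IsProbabilityMeasure μ]
        (ξ : (n : ℕ) → Fin n → Ω → ℝ) (f : ℕ → Step) (S : ℕ → Set Ivl)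
        (s : ℕ → Ω → Step → Ivl → ℝ) (fhat : ℕ → Ω → Step),
        IsSegmentation μ c δ L σ k (fun n => a * √(Real.log n)) ξ f S s fhat →
        RatioVanishes k f →
        Consistent μ k f fhat C) ∧
    -- threshold `η = η(β)`, the `(1 - β)`-quantile of `T(ξ; 0)`, for penalties that do not
    -- depend on the candidate, and `β` polynomially small
    (∀ (c δ : ℝ) (k : ℕ → ℕ) (η : ℕ → ℝ), 1 < c → 0 < δ → ∃ C : ℝ, 0 < C ∧
      ∀ (r R L : ℝ) (σ : ℝ≥0) (β : ℕ → ℝ), 0 < r → 0 < L → 0 < σ →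
      (∀ n, 1 ≤ n → 0 < β n ∧ β n < 1) →
      β =O[atTop] (fun n : ℕ => (n : ℝ) ^ (-r)) →
      (fun n : ℕ => (n : ℝ) ^ (-R)) =O[atTop] β →
      ∀ (Ω : Type*) [MeasurableSpace Ω] (μ : Measure Ω) [IsProbabilityMeasure μ]
        (ξ : (n : ℕ) → Fin n → Ω → ℝ) (f : ℕ → Step) (S : ℕ → Set Ivl)
        (s : ℕ → Ω → Ivl → ℝ) (fhat : ℕ → Ω → Step),
        IsSegmentation μ c δ L σ k η ξ f S (fun n ω _ I => s n ω I) fhat →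
        (∀ n, 1 ≤ n → IsUpperQuantile μ
          (fun ω => T n (S n) (s n ω) (fun i => ξ n i ω) Step.zero) (β n) (η n)) →
        RatioVanishes k f →
        Consistent μ k f fhat C) := by
  have hpow : ∀ {ρ : ℝ}, 0 < ρ → Tendsto (fun n : ℕ => (n : ℝ) ^ (-ρ)) atTop (𝓝 0) := fun hρ =>
    (tendsto_rpow_neg_atTop hρ).comp tendsto_natCast_atTop_atTop
  constructor
  · intro c a k hc
    -- `C` may not depend on `δ`; since `δ < a`, the bound `a + δ ≤ 2a` eliminates it.
    refine ⟨16 * c * (2 * a) ^ 2 + 1, by positivity, ?_⟩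
    intro δ r L σ hδ hr hL hσ ha Ω _ μ _ ξ f S s fhat h hratio
    have hσr : 0 ≤ (σ : ℝ) * √(2 * r + 4) := by positivity
    refine h.consistent hc hL (M := 2 * a) (Eventually.of_forall fun n => ?_) (lt_add_one _)
      hratio ?_
    · rw [← add_mul]
      exact mul_le_mul_of_nonneg_right (by linarith) (Real.sqrt_nonneg _)
    · have hlim : Tendsto (fun n : ℕ => ENNReal.ofReal (8 * (n : ℝ) ^ (-r))) atTop (𝓝 0) := by
        simpa using ENNReal.tendsto_ofReal ((hpow hr).const_mul 8)
      refine tendsto_of_tendsto_of_tendsto_of_le_of_le' tendsto_const_nhds hlim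
        (Eventually.of_forall fun _ => zero_le) ?_
      filter_upwards [eventually_ge_atTop 1] with n hn
      have hb := (h.noise n hn).measure_T_zero_gt_le hσ (h.normal n hn) hn
        (s := fun ω => s n ω (f n)) (δ := δ) (A := a - δ) (ρ := r)
        ((h.penalty n hn).mono fun ω hω => hω (f n)) (by linarith) (by
          have := pow_le_pow_left₀ hσr (by linarith : (σ : ℝ) * √(2 * r + 4) ≤ a - δ) 2
          rwa [mul_pow, Real.sq_sqrt (by positivity)] at this)
      rw [sub_add_cancel] at hb
      exact (measure_mono fun ω hω =>
        lt_of_lt_of_le hω (T_obs_le_T_zero (h.normal n hn) hn _ _ _ _)).trans hb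
  · intro c δ k η hc hδ
    -- `C` must be fixed knowing `η` but not `σ` or `R`, so `K` is read off from `η` itself. If no
    -- `K` exists, `η` is not a quantile sequence of any admissible model and any `C` will do.
    by_cases hη : ∃ K : ℝ, ∀ᶠ n : ℕ in atTop, η n ≤ K * √(Real.log n)
    swap
    · refine ⟨1, one_pos, ?_⟩
      intro r R L σ β hr hL hσ hβ hβr hβR Ω _ μ _ ξ f S s fhat h hq hratio
      refine absurd ?_ hη
      -- As `ρ ≥ R + 1`, the noise tail `8 n^(-ρ)` is at most `8 B β_n / n`, eventually below `β_n`;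
      -- leastness of the quantile then bounds `η n`.
      set ρ := max R 0 + 1 with hρ
      have hρ0 : 0 < ρ := by positivity
      refine ⟨σ * √(2 * ρ + 4) + δ, ?_⟩
      obtain ⟨B, hB0, hB⟩ := hβR.exists_pos
      have hlim : Tendsto (fun n : ℕ => 8 * B * (n : ℝ) ^ (-(1 : ℝ))) atTop (𝓝 0) := by
        simpa using (hpow one_pos).const_mul (8 * B)
      filter_upwards [eventually_ge_atTop 1, hB.bound, hlim.eventually_lt_const one_pos]
        with n hn hBn hsmall
      have hn' : (1 : ℝ) ≤ n := by exact_mod_cast hn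
      refine (hq n hn).2 ?_
      have hb := (h.noise n hn).measure_T_zero_gt_le hσ (h.normal n hn) hn
        (s := s n) (δ := δ) (A := σ * √(2 * ρ + 4)) (ρ := ρ)
        ((h.penalty n hn).mono fun ω hω => hω Step.zero) (by positivity) (by
          rw [mul_pow, Real.sq_sqrt (by positivity)])
      refine hb.trans (ENNReal.ofReal_le_ofReal ?_)
      rw [Real.norm_of_nonneg (by positivity), Real.norm_of_nonneg (hβ n hn).1.le] at hBn
      have h1 : (n : ℝ) ^ (-ρ) ≤ (n : ℝ) ^ (-R) * (n : ℝ) ^ (-(1 : ℝ)) := by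
        rw [← Real.rpow_add (by linarith)]
        exact Real.rpow_le_rpow_of_exponent_le hn' (by linarith [le_max_left R 0])
      calc 8 * (n : ℝ) ^ (-ρ) ≤ 8 * ((n : ℝ) ^ (-R) * (n : ℝ) ^ (-(1 : ℝ))) := by linarith
        _ ≤ 8 * ((B * β n) * (n : ℝ) ^ (-(1 : ℝ))) := by gcongr
        _ = β n * (8 * B * (n : ℝ) ^ (-(1 : ℝ))) := by ring
        _ ≤ β n * 1 := mul_le_mul_of_nonneg_left hsmall.le (hβ n hn).1.le
        _ = β n := mul_one _
    · obtain ⟨K, hK⟩ := hη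
      refine ⟨16 * c * (K + δ) ^ 2 + 1, by positivity, ?_⟩
      intro r R L σ β hr hL hσ hβ hβr hβR Ω _ μ _ ξ f S s fhat h hq hratio
      refine h.consistent hc hL (M := K + δ) (hK.mono fun n hn => ?_) (lt_add_one _) hratio ?_
      · rw [add_mul]
        linarith
      · have hlim : Tendsto (fun n : ℕ => ENNReal.ofReal (β n)) atTop (𝓝 0) := by
          simpa using ENNReal.tendsto_ofReal (hβr.trans_tendsto (hpow hr))
        refine tendsto_of_tendsto_of_tendsto_of_le_of_le' tendsto_const_nhds hlim
          (Eventually.of_forall fun _ => zero_le) ?_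
        filter_upwards [eventually_ge_atTop 1] with n hn
        exact (measure_mono fun ω hω =>
          lt_of_lt_of_le hω (T_obs_le_T_zero (h.normal n hn) hn _ _ _ _)).trans (hq n hn).1
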